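/- Let $n,N\in\mathbb N$ and let $P_1,\dots,P_n$ be probability measures on a product $\mathbb X\times\mathbb Y$ of measurable spaces. Let $\mathcal H$ be a set of measurable maps $h:\mathbb X\to\mathbb X'$, where $\mathbb X'$ is a measurable space, and let $\ell:\mathbb X'\times\mathbb Y\to\{u,v\}$ be a measurable loss with two real values $-1\le u<v\le 1$ (for example $\{-1,+1\}$ or $\{0,1\}$); let $M\ge v-u$, so that the values of $\ell$ lie in an interval of length $M$. Let $\mathcal G=\{(x,y)\mapsto \ell(h(x),y):h\in\mathcal H\}$, and let $\mathrm{VC}(\mathcal G)$ be its Vapnik–Chervonenkis dimension, i.e. that of the family of sets $\{g=v\}$, $g\in\mathcal G$. Let $A,B\subset\Delta^{n-1}=\{c\in\mathbb R^n: c_i\ge 0,\ \sum_i c_i=1\}$ be nonempty and compact, let $\varphi\in[0,1)$, and put $\Lambda=\Lambda_\varphi(A,B)=\{\tfrac1{1-\varphi}(a-\varphi b): a\in A,\ b\in B\}$. Let $$\mathfrak s(\lambda)=n\sum_{i=1}^n\Big|\lambda_i-\frac1n\Big|^2+1,\qquad \mathfrak s(\Lambda)=\max_{\lambda\in\Lambda}\mathfrak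 s(\lambda),$$ and, for $\epsilon>0$, let $\mathcal N(\Lambda,\|\cdot\|_1,\epsilon)$ be the least number of closed $\ell^1$-balls of radius $\epsilon$ with centres in $\Lambda$ that cover $\Lambda$. Let $(x_{i,j},y_{i,j})$, $1\le i\le n$, $1\le j\le N$, be independent with $(x_{i,j},y_{i,j})\sim P_i$, and put $$L_\lambda(h)=\sum_{i=1}^n\lambda_i\,\mathbb E_{(x,y)\sim P_i}[\ell(h(x),y)],\qquad L_{\lambda,Nn}(h)=\sum_{i=1}^n\frac{\lambda_i}{N}\sum_{j=1}^N\ell(h(x_{i,j}),y_{i,j}).$$ Suppose that, for each fixed $\lambda\in\Lambda$ and each fixed array of signs $\sigma_{i,j}\in\{-1,+1\}$, the suprema $\sup_{h\in\mathcal H}(L_\lambda(h)-L_{\lambda,Nn}(h))$ and $\sup_{h\in\mathcal H}\sum_i\frac{\lambda_i}N\sum_j\sigma_{i,j}\ell(h(x_{i,j}),y_{i,j})$ are measurable functions of the sample, with respect to the completed law of the sample (automatic for countable $\mathcal H$). If $\mathrm{VC}(\mathcal G)<Nn$, then for all $\epsilon>0$ and $\delta>0$, with probability at least $1-\delta$,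 for all $h\in\mathcal H$ and all $\lambda\in\Lambda$ simultaneously, $$L_\lambda(h)\le L_{\lambda,Nn}(h)+M\epsilon+\sqrt{\frac{\mathfrak s(\Lambda)}{2Nn}}\left(4\sqrt{\mathrm{VC}(\mathcal G)}\sqrt{1+\log\frac{Nn}{\mathrm{VC}(\mathcal G)}}+M\sqrt{\log\frac{\mathcal N(\Lambda,\|\cdot\|_1,\epsilon)}{\delta}}\right).$$ Here the first term in the bracket is read as $0$ if $\mathrm{VC}(\mathcal G)=0$, and $\sqrt{t}$ is read as $0$ for $t<0$ (which occurs only if $\delta>1$). -/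

import Mathlib

open MeasureTheory ProbabilityTheory

noncomputable section

namespace FairFL

/-- The integrated ambiguity set `Λ_φ(A, B) = {(a - φ b) / (1 - φ) : a ∈ A, b ∈ B}`. -/
def integratedSet {n : ℕ} (φ : ℝ) (A B : Set (Fin n → ℝ)) : Set (Fin n → ℝ) :=
  {w | ∃ a ∈ A, ∃ b ∈ B, w = (1 / (1 - φ)) • (a - φ • b)}

/-- The skewness of a weight vector, `n ∑ |λ_i - 1/n|² + 1`. -/
def skewness {n : ℕ} (w : Fin n → ℝ) : ℝ :=
  n * ∑ i, |w i - 1 / n| ^ 2 + 1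

/-- The skewness of a set of weight vectors: the largest skewness of its elements
(a maximum on a nonempty compact set). -/
def setSkewness {n : ℕ} (L : Set (Fin n → ℝ)) : ℝ :=
  sSup (skewness '' L)

/-- The covering number of a set of weight vectors in the norm `‖x‖₁ = ∑ |x_i|`: the least number
of closed balls of radius `ε`, with centres in the set, that cover the set. -/
def l1CoveringNumber {n : ℕ} (L : Set (Fin n → ℝ)) (ε : ℝ) : ℕ∞ :=
  Metric.coveringNumber ε.toNNReal ((WithLp.toLp 1 : (Fin n → ℝ) → PiLp 1 fun _ => ℝ) '' L)

/-- A finite set `S` is shattered by a family `C` of sets if every subset of `S` is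
the trace on `S` of a member of `C`. -/
def IsShattered {Z : Type*} (C : Set (Set Z)) (S : Finset Z) : Prop :=
  ∀ T ⊆ S, ∃ c ∈ C, ∀ z ∈ S, z ∈ c ↔ z ∈ T

/-- The Vapnik-Chervonenkis dimension of a family of sets, `⊤` if it is infinite. -/
def vcDim {Z : Type*} (C : Set (Set Z)) : ℕ∞ :=
  ⨆ (S : Finset Z) (_ : IsShattered C S), (S.card : ℕ∞)

/-- The family `G` of the losses `(x, y) ↦ ℓ(h(x), y)` of the hypotheses `h ∈ H`. -/
def lossClass {X Y X' : Type*} (ℓ : X' × Y → ℝ) (H : Set (X → X')) : Set (X × Y → ℝ) :=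
  {g | ∃ h ∈ H, g = fun z => ℓ (h z.1, z.2)}

/-- The Vapnik-Chervonenkis dimension of a class of functions with at most two values, one of
which is `v`: that of the family of the sets `{g = v}`. (The other value gives the family of the
complements, which shatters the same sets.) -/
def binaryVCDim {Z : Type*} (v : ℝ) (G : Set (Z → ℝ)) : ℕ∞ :=
  vcDim ((fun g => g ⁻¹' {v}) '' G)

/-- The weighted risk `L_λ(h) = ∑ λ_i E_{(x, y) ∼ P_i} ℓ(h(x), y)`. -/
def risk {X Y X' : Type*} [MeasurableSpace X] [MeasurableSpace Y] {n : ℕ}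
    (P : Fin n → Measure (X × Y)) (ℓ : X' × Y → ℝ) (w : Fin n → ℝ) (h : X → X') : ℝ :=
  ∑ i, w i * ∫ z, ℓ (h z.1, z.2) ∂(P i)

/-- The empirical weighted risk `L_{λ,Nn}(h) = ∑ (λ_i / N) ∑ ℓ(h(x_ij), y_ij)`
on a sample `s (i, j) = (x_ij, y_ij)`. -/
def empRisk {X Y X' : Type*} {n N : ℕ} (s : Fin n × Fin N → X × Y)
    (ℓ : X' × Y → ℝ) (w : Fin n → ℝ) (h : X → X') : ℝ :=
  ∑ i, w i / N * ∑ j, ℓ (h (s (i, j)).1, (s (i, j)).2)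

/-- The law of the whole sample: independent points, the `j`-th point of client `i` of law `P i`. -/
def sampleLaw {X Y : Type*} [MeasurableSpace X] [MeasurableSpace Y] {n : ℕ} (N : ℕ)
    (P : Fin n → Measure (X × Y)) : Measure (Fin n × Fin N → X × Y) :=
  Measure.pi fun k => P k.1

/-- The measurability convention for suprema over the hypothesis class: for all weights in `L`, the
largest excess of the risk over the empirical risk, and the largest signed empirical risk
(whose mean over random signs is the weighted Rademacher complexity),
are random variables on the (completed) space of samples. -/
structure HasMeasurableSuprema {X Y X' : Type*} [MeasurableSpace X] [MeasurableSpace Y] {n : ℕ}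
    (N : ℕ) (P : Fin n → Measure (X × Y)) (ℓ : X' × Y → ℝ) (H : Set (X → X'))
    (L : Set (Fin n → ℝ)) : Prop where
  excess : ∀ w ∈ L, AEMeasurable
    (fun s : Fin n × Fin N → X × Y => ⨆ h : H, (risk P ℓ w h.1 - empRisk s ℓ w h.1))
    (sampleLaw N P)
  signed : ∀ w ∈ L, ∀ σ : Fin n × Fin N → ℝ, (∀ k, σ k = -1 ∨ σ k = 1) → AEMeasurable
    (fun s : Fin n × Fin N → X × Y =>
      ⨆ h : H, ∑ i, w i / N * ∑ j, σ (i, j) * ℓ (h.1 (s (i, j)).1, (s (i, j)).2))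
    (sampleLaw N P)

end FairFL

end

/-! Fix a weight vector `λ` and put `b_k = λ_i / N` for the sample point `k = (i, j)`. The largest
excess of the weighted risk over the empirical one is a function of `Nn` independent points, and
replacing point `k` changes it by at most `M |b_k|`. McDiarmid's inequality
(`hasSubgaussianMGF_of_boundedDifferences`) thus gives it a Gaussian upper tail around its mean,
with variance proxy `M² ∑ b_k² / 4`.

The mean is at most twice a Rademacher average (`integral_iSup_deviation_le`). On a given sample a
two-valued class yields only as many vectors as it has traces, hence at most `exp (d (1 + log (Nn /
d)))` of them by Sauer–Shelah (`card_traces_le`), and Massart's lemma (`sum_signs_le_of_finset`)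
turns this count into the VC term.

Both estimates see the weights only through `∑ b_k²`. Since the weights sum to one, this is the
skewness divided by `Nn` (`sum_weight_sq_eq`). Uniformity in `λ` comes from a union bound over a
minimal `ℓ¹` net; moving from `λ` to a net point costs `M ε`, because the gap is `M`-Lipschitz in
the weights (`risk_sub_empRisk_le`). -/

namespace FairFL

/-! ### McDiarmid's inequality -/

section BoundedDifferences

variable {Z : Type*} [MeasurableSpace Z]

/-- Prepending a coordinate is measure preserving for product measures. -/
theorem measurePreserving_cons {m : ℕ} (μ : Fin (m + 1) → Measure Z)
    [∀ i, IsProbabilityMeasure (μ i)] :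
    MeasurePreserving (fun p : (Fin m → Z) × Z => (Fin.cons p.2 p.1 : Fin (m + 1) → Z))
      ((Measure.pi fun i => μ i.succ).prod (μ 0)) (Measure.pi μ) := by
  have h := (measurePreserving_piFinSuccAbove μ 0).symm
  have h2 := h.comp (Measure.measurePreserving_swap
    (μ := (Measure.pi fun i : Fin m => μ i.succ)) (ν := μ 0))
  convert h2 using 1
  funext p
  simp [MeasurableEquiv.piFinSuccAbove_symm_apply, Fin.insertNthEquiv, Fin.insertNth_zero']

/-- Exponential moment form of the bounded differences inequality. The bounded differences are
required everywhere, the measurability only up to a null set. -/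
theorem integral_exp_le_of_boundedDifferences (m : ℕ) (μ : Fin m → Measure Z)
    [∀ i, IsProbabilityMeasure (μ i)] (f : (Fin m → Z) → ℝ) (K : ℝ) (c : Fin m → ℝ)
    (hf : AEMeasurable f (Measure.pi μ)) (hK : ∀ x, f x ∈ Set.Icc 0 K)
    (hc : ∀ x i z, f x - f (Function.update x i z) ≤ c i) :
    ∫ x, Real.exp (f x) ∂(Measure.pi μ) ≤
      Real.exp (∫ x, f x ∂(Measure.pi μ) + (∑ i, c i ^ 2) / 8) := by
  induction m with
  | zero => 
    rw [Measure.pi_of_empty μ fun i => i.elim0]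
    simp
  | succ m ih =>
    have hmp := measurePreserving_cons μ
    set ν := Measure.pi fun i : Fin m => μ i.succ with hν
    set Φ : (Fin m → Z) × Z → (Fin (m + 1) → Z) := fun p => Fin.cons p.2 p.1 with hΦ
    set F : (Fin m → Z) × Z → ℝ := fun p => f (Φ p) with hF
    have hFm : AEMeasurable F (ν.prod (μ 0)) := hf.comp_quasiMeasurePreserving
      hmp.quasiMeasurePreserving
    have hFK : ∀ p, F p ∈ Set.Icc 0 K := fun p => hK _
    have hFi : Integrable F (ν.prod (μ 0)) := .of_mem_Icc 0 K hFm (.of_forall hFK)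
    have hexpi : Integrable (fun p => Real.exp (F p)) (ν.prod (μ 0)) :=
      .of_mem_Icc 0 (Real.exp K) (Real.measurable_exp.comp_aemeasurable hFm)
        (.of_forall fun p => ⟨(Real.exp_pos _).le, Real.exp_le_exp.2 (hFK p).2⟩)
    have hZ : Nonempty Z := (μ 0).nonempty_of_neZero
    have hΦupd : ∀ x i z w, Φ (Function.update x i z, w) = Function.update (Φ (x, w)) i.succ z :=
      fun x i z w => by simp [hΦ, Fin.cons_update]
    have hsec : ∀ᵐ x ∂ν, AEMeasurable (fun z => F (x, z)) (μ 0) := by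
      filter_upwards [hFm.aestronglyMeasurable.prodMk_left] with x hx using hx.aemeasurable
    -- The first coordinate is integrated out by a lower integral. It is monotone even on the null
    -- set of non-measurable sections, so the bounded differences pass to `g` at every point, as the
    -- induction hypothesis demands; a Bochner integral would take the value 0 there. This is why
    -- `f` is assumed nonnegative.
    set l : (Fin m → Z) → ENNReal := fun x => ∫⁻ z, ENNReal.ofReal (F (x, z)) ∂(μ 0) with hl
    have hlK : ∀ x, l x ≤ ENNReal.ofReal K := fun x => by
      calc l x ≤ ∫⁻ z, ENNReal.ofReal K ∂(μ 0) :=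
            lintegral_mono fun z => ENNReal.ofReal_le_ofReal (hFK _).2
        _ = _ := by simp
    have hltop : ∀ x, l x ≠ ⊤ := fun x => ((hlK x).trans_lt ENNReal.ofReal_lt_top).ne
    set g : (Fin m → Z) → ℝ := fun x => (l x).toReal with hg
    have hgm : AEMeasurable g ν := (hFm.ennreal_ofReal.lintegral_prod_right').ennreal_toReal
    have hK0 : 0 ≤ K := by
      have x : Fin (m + 1) → Z := fun _ => hZ.some
      exact (hK x).1.trans (hK x).2
    have hgK : ∀ x, g x ∈ Set.Icc 0 K := fun x =>
      ⟨ENNReal.toReal_nonneg, ENNReal.toReal_le_of_le_ofReal hK0 (hlK x)⟩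
    have hgc : ∀ x i z, g x - g (Function.update x i z) ≤ c i.succ := fun x i z => by
      have hc0 : 0 ≤ c i.succ := by
        simpa using hc (Φ (x, hZ.some)) i.succ (Φ (x, hZ.some) i.succ)
      have : l x ≤ l (Function.update x i z) + ENNReal.ofReal (c i.succ) := by
        calc l x ≤ ∫⁻ w, (ENNReal.ofReal (F (Function.update x i z, w))
                + ENNReal.ofReal (c i.succ)) ∂(μ 0) := by
              refine lintegral_mono fun w => ?_
              rw [← ENNReal.ofReal_add (hFK _).1 hc0]
              refine ENNReal.ofReal_le_ofReal ?_
              have := hc (Φ (x, w)) i.succ z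
              rw [← hΦupd] at this
              simp only [hF]
              linarith
          _ = _ := by rw [lintegral_add_right _ measurable_const]; simp [hl]
      have h2 := ENNReal.toReal_mono (by finiteness [hltop (Function.update x i z)]) this
      rw [ENNReal.toReal_add (hltop _) ENNReal.ofReal_ne_top, ENNReal.toReal_ofReal hc0] at h2
      simp only [hg]
      linarith
    have hgint : ∀ᵐ x ∂ν, g x = ∫ z, F (x, z) ∂(μ 0) := by
      filter_upwards [hsec] with x hx
      rw [integral_eq_lintegral_of_nonneg_ae (.of_forall fun z => (hFK _).1)
        hx.aestronglyMeasurable]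
    have hstep : ∀ᵐ x ∂ν, ∫ z, Real.exp (F (x, z)) ∂(μ 0)
        ≤ Real.exp (c 0 ^ 2 / 8) * Real.exp (g x) := by
      filter_upwards [hsec, hgint] with x hx hgx
      -- With the other coordinates frozen, `F` ranges over an interval of length `c 0`, so
      -- Hoeffding's lemma at parameter 1 gives the factor `exp (c 0 ^ 2 / 8)`.
      set a := ⨅ z, F (x, z) with ha
      have hbdd : BddBelow (Set.range fun z => F (x, z)) := ⟨0, by
        rintro _ ⟨z, rfl⟩; exact (hFK _).1⟩
      have hab : ∀ z, F (x, z) ∈ Set.Icc a (a + c 0) := fun z => by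
        refine ⟨ciInf_le hbdd z, ?_⟩
        suffices F (x, z) - c 0 ≤ a by linarith
        refine le_ciInf fun w => ?_
        have := hc (Φ (x, z)) 0 w
        have h3 : Function.update (Φ (x, z)) 0 w = Φ (x, w) := by
          simp only [hΦ]
          exact Fin.update_cons_zero _ _ _
        rw [h3] at this
        simp only [hF]
        linarith
      have hs := (hasSubgaussianMGF_of_mem_Icc hx (.of_forall hab)).mgf_le 1
      simp only [mgf, one_mul, Real.exp_sub, integral_div, ← hgx] at hs
      rw [div_le_iff₀ (Real.exp_pos _)] at hs
      have hV : (((‖a + c 0 - a‖₊ / 2) ^ 2 : NNReal) : ℝ) * 1 ^ 2 / 2 = c 0 ^ 2 / 8 := by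
        simp [div_pow, sq_abs]
        ring
      rwa [hV] at hs
    have hgexpi : Integrable (fun x => Real.exp (g x)) ν :=
      .of_mem_Icc 0 (Real.exp K) (Real.measurable_exp.comp_aemeasurable hgm)
        (.of_forall fun p => ⟨(Real.exp_pos _).le, Real.exp_le_exp.2 (hgK p).2⟩)
    have hint : ∫ x, f x ∂(Measure.pi μ) = ∫ x, g x ∂ν := by
      rw [← hmp.map_eq, integral_map hmp.measurable.aemeasurable
        (by rw [hmp.map_eq]; exact hf.aestronglyMeasurable), integral_prod _ hFi]
      exact integral_congr_ae (hgint.mono fun x hx => hx.symm)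
    have hexp : ∫ x, Real.exp (f x) ∂(Measure.pi μ) =
        ∫ x, ∫ z, Real.exp (F (x, z)) ∂(μ 0) ∂ν := by
      rw [← hmp.map_eq, integral_map hmp.measurable.aemeasurable
        (by rw [hmp.map_eq]; exact
          (Real.measurable_exp.comp_aemeasurable hf).aestronglyMeasurable), integral_prod _ hexpi]
    rw [hexp, hint, Fin.sum_univ_succ]
    calc _ ≤ ∫ x, Real.exp (c 0 ^ 2 / 8) * Real.exp (g x) ∂ν :=
          integral_mono_ae hexpi.integral_prod_left (hgexpi.const_mul _) hstep
      _ = Real.exp (c 0 ^ 2 / 8) * ∫ x, Real.exp (g x) ∂ν := integral_const_mul _ _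
      _ ≤ Real.exp (c 0 ^ 2 / 8) *
          Real.exp (∫ x, g x ∂ν + (∑ i : Fin m, c i.succ ^ 2) / 8) := by
        refine mul_le_mul_of_nonneg_left ?_ (Real.exp_pos _).le
        exact ih (fun i => μ i.succ) g (fun i => c i.succ) hgm hgK hgc
      _ = _ := by rw [← Real.exp_add]; ring_nf

variable {ι : Type*} [Fintype ι] [DecidableEq ι]

theorem integral_exp_le_of_boundedDifferences_fintype (μ : ι → Measure Z)
    [∀ i, IsProbabilityMeasure (μ i)] (f : (ι → Z) → ℝ) (K : ℝ) (c : ι → ℝ)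
    (hf : AEMeasurable f (Measure.pi μ)) (hK : ∀ x, f x ∈ Set.Icc 0 K)
    (hc : ∀ x i z, f x - f (Function.update x i z) ≤ c i) :
    ∫ x, Real.exp (f x) ∂(Measure.pi μ) ≤
      Real.exp (∫ x, f x ∂(Measure.pi μ) + (∑ i, c i ^ 2) / 8) := by
  set e := (Fintype.equivFin ι).symm
  have hmp := measurePreserving_piCongrLeft μ e
  set Φ := MeasurableEquiv.piCongrLeft (fun _ : ι => Z) e with hΦ
  have hΦe : ∀ x i, Φ x (e i) = x i := fun x i => by
    simp [hΦ, MeasurableEquiv.piCongrLeft_apply_apply]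
  have h := integral_exp_le_of_boundedDifferences _ (fun i => μ (e i)) (fun x => f (Φ x)) K
    (fun i => c (e i)) (hf.comp_quasiMeasurePreserving hmp.quasiMeasurePreserving)
    (fun x => hK _) (fun x i z => by
      convert hc (Φ x) (e i) z using 3
      ext j
      obtain ⟨k, rfl⟩ := e.surjective j
      rw [hΦe]
      simp [Function.update_apply, hΦe])
  rw [e.sum_comp (fun i => c i ^ 2)] at h
  rw [← hmp.integral_comp', ← hmp.integral_comp']
  exact h

/-- **McDiarmid's inequality**: a function with bounded differences is sub-Gaussian under
a product measure. -/
theorem hasSubgaussianMGF_of_boundedDifferences (μ : ι → Measure Z)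
    [∀ i, IsProbabilityMeasure (μ i)] (f : (ι → Z) → ℝ) (a b : ℝ) (c : ι → ℝ) (V : NNReal)
    (hV : ∑ i, c i ^ 2 ≤ 4 * V)
    (hf : AEMeasurable f (Measure.pi μ)) (hab : ∀ x, f x ∈ Set.Icc a b)
    (hc : ∀ x i z, f x - f (Function.update x i z) ≤ c i) :
    HasSubgaussianMGF (fun x => f x - ∫ y, f y ∂(Measure.pi μ)) V (Measure.pi μ) where
  integrable_exp_mul t := integrable_exp_mul_of_mem_Icc
    (a := a - ∫ y, f y ∂(Measure.pi μ)) (b := b - ∫ y, f y ∂(Measure.pi μ)) (hf.sub_const _)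
    (.of_forall fun x => ⟨sub_le_sub_right (hab x).1 _, sub_le_sub_right (hab x).2 _⟩)
  mgf_le t := by
    have hfi : Integrable f (Measure.pi μ) := .of_mem_Icc a b hf (.of_forall hab)
    set ν := Measure.pi μ
    -- Adding `D` moves `t * f` into `[0, 2 * D]`, as the exponential bound requires; the factor
    -- `exp D` cancels afterwards.
    set D := |t| * max |a| |b| with hD
    have hDf : ∀ x, |t * f x| ≤ D := fun x => by
      rw [abs_mul, hD]
      gcongr
      exact abs_le_max_abs_abs (hab x).1 (hab x).2
    have hc' : ∀ x i z, t * f x + D - (t * f (Function.update x i z) + D) ≤ |t| * c i := by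
      intro x i z
      have h1 := hc x i z
      -- Undoing the update gives the reverse inequality, so negative `t` is covered too.
      have h2 := hc (Function.update x i z) i (x i)
      simp only [Function.update_idem, Function.update_eq_self] at h2
      calc _ = t * (f x - f (Function.update x i z)) := by ring
        _ ≤ |t * (f x - f (Function.update x i z))| := le_abs_self _
        _ ≤ |t| * c i := by
          rw [abs_mul]
          gcongr
          exact abs_le.2 ⟨by linarith, h1⟩
    have h := integral_exp_le_of_boundedDifferences_fintype μ (fun x => t * f x + D) (2 * D)
      (fun i => |t| * c i) ((hf.const_mul t).add_const D)
      (fun x => ⟨by linarith [(abs_le.1 (hDf x)).1], by linarith [(abs_le.1 (hDf x)).2]⟩) hc'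
    rw [integral_add (hfi.const_mul t) (integrable_const _), integral_const_mul] at h
    simp only [Real.exp_add, integral_mul_const, integral_const, probReal_univ, smul_eq_mul,
      one_mul, mul_pow, sq_abs, ← Finset.mul_sum] at h
    have h' : ∫ x, Real.exp (t * f x) ∂ν ≤ Real.exp (t * ∫ y, f y ∂ν) *
        Real.exp (t ^ 2 * (∑ i, c i ^ 2) / 8) := by
      have := Real.exp_pos D
      nlinarith
    simp only [mgf, mul_sub, Real.exp_sub, integral_div]
    rw [div_le_iff₀ (Real.exp_pos _), mul_comm]
    refine h'.trans (mul_le_mul_of_nonneg_left (Real.exp_le_exp.2 ?_) (Real.exp_pos _).le)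
    nlinarith [sq_nonneg t]

end BoundedDifferences

/-! ### Random signs and Massart's lemma -/

section Rademacher

variable {ι : Type*} [Fintype ι] [DecidableEq ι]

/-- The arrays of signs. -/
noncomputable def signs (ι : Type*) [Fintype ι] [DecidableEq ι] : Finset (ι → ℝ) :=
  Fintype.piFinset fun _ => {-1, 1}

theorem mem_signs {σ : ι → ℝ} : σ ∈ signs ι ↔ ∀ k, σ k = -1 ∨ σ k = 1 := by
  simp [signs]

theorem signs_nonempty : (signs ι).Nonempty := ⟨fun _ => 1, by simp [mem_signs]⟩

theorem card_signs_pos : (0 : ℝ) < (signs ι).card := by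
  exact_mod_cast signs_nonempty.card_pos

theorem card_signs : ((signs ι).card : ℝ) = 2 ^ Fintype.card ι := by
  have : ({-1, 1} : Finset ℝ).card = 2 := Finset.card_pair (by norm_num)
  simp [signs, this]

theorem neg_mem_signs {σ : ι → ℝ} : -σ ∈ signs ι ↔ σ ∈ signs ι := by
  simp only [mem_signs, Pi.neg_apply, neg_eq_iff_eq_neg, neg_neg]
  exact forall_congr' fun k => or_comm

theorem sum_signs_neg (F : (ι → ℝ) → ℝ) : ∑ σ ∈ signs ι, F (-σ) = ∑ σ ∈ signs ι, F σ :=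
  Finset.sum_equiv (Equiv.neg _) (fun _ => neg_mem_signs.symm) fun _ _ => rfl

/-- The sum factorizes over the coordinates into terms `2 cosh (a k)`, and `cosh x ≤ exp (x² / 2)`.
-/
theorem sum_signs_exp_le (a : ι → ℝ) :
    ∑ σ ∈ signs ι, Real.exp (∑ k, σ k * a k) ≤
      (signs ι).card * Real.exp ((∑ k, a k ^ 2) / 2) := by
  have h : ∑ σ ∈ signs ι, Real.exp (∑ k, σ k * a k) = ∏ k, (2 * Real.cosh (a k)) := by
    simp_rw [Real.exp_sum]
    rw [signs, ← Finset.prod_univ_sum (fun _ => {-1, 1}) (fun k x => Real.exp (x * a k))]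
    refine Finset.prod_congr rfl fun k _ => ?_
    rw [Finset.sum_pair (by norm_num), Real.cosh_eq]
    simp only [neg_mul, one_mul]
    ring
  rw [h, Finset.prod_mul_distrib, card_signs, Finset.sum_div, Real.exp_sum]
  simp only [Finset.prod_const, Finset.card_univ]
  gcongr with k
  exact Real.cosh_le_exp_half_sq _

/-- Optimizes the free parameter of a Chernoff argument. A quadratic that is nonnegative on the
whole line has nonpositive discriminant, which avoids dividing by `R` and so includes `R = 0`. -/
theorem le_sqrt_of_forall_mul_le {x L R : ℝ} (hR : 0 ≤ R) (hL : 0 ≤ L)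
    (h : ∀ t > 0, t * x ≤ L + t ^ 2 * R / 2) : x ≤ √(2 * L * R) := by
  rcases lt_or_ge x 0 with hx | hx
  · exact hx.le.trans (Real.sqrt_nonneg _)
  refine Real.le_sqrt_of_sq_le ?_
  have := discrim_le_zero (a := R / 2) (b := -x) (c := L) fun t => by
    rcases lt_or_ge 0 t with ht | ht
    · nlinarith [h t ht]
    · nlinarith [mul_nonneg hR (mul_self_nonneg t), mul_nonneg (neg_nonneg.2 ht) hx]
  rw [discrim] at this
  nlinarith

/-- **Massart's lemma** on the Rademacher average of a finite set of vectors. -/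
theorem sum_signs_le_of_finset (A : Finset (ι → ℝ)) {R L : ℝ} (hR : ∀ a ∈ A, ∑ k, a k ^ 2 ≤ R)
    (hR0 : 0 ≤ R) (hL : 0 ≤ L) (hcard : (A.card : ℝ) ≤ Real.exp L) (F : (ι → ℝ) → ℝ)
    (hF : ∀ σ ∈ signs ι, ∃ a ∈ A, F σ ≤ ∑ k, σ k * a k) :
    ∑ σ ∈ signs ι, F σ ≤ (signs ι).card * √(2 * L * R) := by
  have hpos := card_signs_pos (ι := ι)
  rw [← div_le_iff₀' hpos]
  refine le_sqrt_of_forall_mul_le hR0 hL fun t ht => ?_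
  rw [← Real.exp_le_exp]
  have hj := convexOn_exp.map_sum_le (t := signs ι) (w := fun _ => ((signs ι).card : ℝ)⁻¹)
    (p := fun σ => t * F σ) (fun _ _ => by positivity) (by simp [hpos.ne'])
    (fun _ _ => Set.mem_univ _)
  simp only [smul_eq_mul, ← Finset.mul_sum] at hj
  calc Real.exp (t * ((∑ σ ∈ signs ι, F σ) / (signs ι).card))
      = Real.exp (((signs ι).card : ℝ)⁻¹ * (t * ∑ σ ∈ signs ι, F σ)) := by ring_nf
    _ ≤ ((signs ι).card : ℝ)⁻¹ * ∑ σ ∈ signs ι, Real.exp (t * F σ) := hj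
    _ ≤ ((signs ι).card : ℝ)⁻¹ *
        ∑ σ ∈ signs ι, ∑ a ∈ A, Real.exp (∑ k, σ k * (t * a k)) := by
      -- The exponential of a maximum over `A` is at most the sum of the exponentials over `A`.
      gcongr with σ hσ
      obtain ⟨a, ha, hle⟩ := hF σ hσ
      refine le_trans ?_ (Finset.single_le_sum
        (f := fun a => Real.exp (∑ k, σ k * (t * a k))) (fun _ _ => (Real.exp_pos _).le) ha)
      rw [Real.exp_le_exp]
      calc t * F σ ≤ t * ∑ k, σ k * a k := by gcongr
        _ = _ := by rw [Finset.mul_sum]; exact Finset.sum_congr rfl fun k _ => by ring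
    _ = ((signs ι).card : ℝ)⁻¹ *
        ∑ a ∈ A, ∑ σ ∈ signs ι, Real.exp (∑ k, σ k * (t * a k)) := by rw [Finset.sum_comm]
    _ ≤ ((signs ι).card : ℝ)⁻¹ *
        ∑ a ∈ A, (signs ι).card * Real.exp (t ^ 2 * R / 2) := by
      gcongr with a ha
      refine (sum_signs_exp_le _).trans ?_
      gcongr
      simp only [mul_pow, ← Finset.mul_sum]
      gcongr
      exact hR a ha
    _ = A.card * Real.exp (t ^ 2 * R / 2) := by
      rw [Finset.sum_const, nsmul_eq_mul]
      field_simp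
    _ ≤ Real.exp (L + t ^ 2 * R / 2) := by
      rw [Real.exp_add]
      gcongr

end Rademacher

/-! ### Sauer–Shelah and the Rademacher average of a VC class -/

section Sauer

/-- With `q = d / m ≤ 1`, multiply by `q ^ d ≤ q ^ k` for `k ≤ d`; the binomial theorem then bounds
the sum by `(1 + q) ^ m ≤ exp d`. -/
theorem sum_choose_le_exp {m d : ℕ} (hd : d ≤ m) (hm : 0 < m) :
    ((∑ k ∈ Finset.Iic d, m.choose k : ℕ) : ℝ) ≤ Real.exp (d * (1 + Real.log (m / d))) := by
  rcases Nat.eq_zero_or_pos d with rfl | hd0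
  · have : Finset.Iic 0 = ({0} : Finset ℕ) := by ext; simp
    simp [this]
  have hm' : (0 : ℝ) < m := by exact_mod_cast hm
  have hd' : (0 : ℝ) < d := by exact_mod_cast hd0
  set q : ℝ := d / m with hq
  have hq0 : 0 < q := by positivity
  have hq1 : q ≤ 1 := (div_le_one hm').2 (by exact_mod_cast hd)
  have h1 : ((∑ k ∈ Finset.Iic d, m.choose k : ℕ) : ℝ) * q ^ d ≤ Real.exp d := by
    calc ((∑ k ∈ Finset.Iic d, m.choose k : ℕ) : ℝ) * q ^ d
        = ∑ k ∈ Finset.Iic d, (m.choose k : ℝ) * q ^ d := by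
          rw [Nat.cast_sum, Finset.sum_mul]
      _ ≤ ∑ k ∈ Finset.Iic d, (m.choose k : ℝ) * q ^ k := by
          gcongr ∑ k ∈ _, _ * ?_ with k hk
          exact pow_le_pow_of_le_one hq0.le hq1 (Finset.mem_Iic.1 hk)
      _ ≤ ∑ k ∈ Finset.range (m + 1), (m.choose k : ℝ) * q ^ k := by
          refine Finset.sum_le_sum_of_subset_of_nonneg (fun k hk => ?_)
            fun _ _ _ => by positivity
          have := Finset.mem_Iic.1 hk
          exact Finset.mem_range.2 (by omega)
      _ = (q + 1) ^ m := by
          rw [add_pow]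
          exact Finset.sum_congr rfl fun k _ => by simp [mul_comm]
      _ ≤ (Real.exp q) ^ m := by
          gcongr
          exact Real.add_one_le_exp q
      _ = Real.exp d := by
          rw [← Real.exp_nat_mul]
          congr 1
          rw [hq]
          field_simp
  have h2 : Real.exp (d * (1 + Real.log (m / d))) = Real.exp d / q ^ d := by
    rw [mul_add, mul_one, Real.exp_add, Real.exp_nat_mul, Real.exp_log (by positivity), hq,
      div_eq_mul_inv (Real.exp _), ← inv_pow, inv_div]
  rw [h2, le_div_iff₀ (by positivity)]
  exact h1

variable {ι W : Type*} [Fintype ι]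

open Classical in
/-- The traces of a family of sets on a finite sequence of points. -/
noncomputable def traces (C : Set (Set W)) (s : ι → W) : Finset (Finset ι) :=
  Finset.univ.filter fun T => ∃ c ∈ C, ∀ k, s k ∈ c ↔ k ∈ T

theorem mem_traces {C : Set (Set W)} {s : ι → W} {T : Finset ι} :
    T ∈ traces C s ↔ ∃ c ∈ C, ∀ k, s k ∈ c ↔ k ∈ T := by
  simp [traces]

variable [DecidableEq ι]

/-- The sample may repeat points, but two indices with the same point lie in the same traces and
cannot be separated. Hence a shattered set of indices maps injectively onto a shattered set of
points. -/
theorem vcDim_traces_le {C : Set (Set W)} {d : ℕ} (hd : vcDim C ≤ d) (s : ι → W) :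
    (traces C s).vcDim ≤ d := by
  classical
  refine Finset.sup_le fun S hS => ?_
  rw [Finset.mem_shatterer] at hS
  have hinj : Set.InjOn s S := by
    intro k hk l hl hkl
    obtain ⟨U, hU, hSU⟩ := hS (Finset.singleton_subset_iff.2 hk)
    obtain ⟨c, -, hc⟩ := mem_traces.1 hU
    have h1 : k ∈ S ∩ U := by rw [hSU]; simp
    have h2 : l ∈ U := by
      rw [← hc, ← hkl, hc]
      exact (Finset.mem_inter.1 h1).2
    have h3 : l ∈ S ∩ U := Finset.mem_inter.2 ⟨hl, h2⟩
    rw [hSU] at h3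
    exact (Finset.mem_singleton.1 h3).symm
  have hsh : IsShattered C (S.image s) := by
    intro T hT
    obtain ⟨U, hU, hSU⟩ := hS (Finset.filter_subset (fun k => s k ∈ T) S)
    obtain ⟨c, hcC, hc⟩ := mem_traces.1 hU
    refine ⟨c, hcC, fun z hz => ?_⟩
    obtain ⟨k, hk, rfl⟩ := Finset.mem_image.1 hz
    have := congrArg (k ∈ ·) hSU
    simp only [Finset.mem_inter, Finset.mem_filter, hk, true_and, eq_iff_iff] at this
    rw [hc, this]
  have h := (le_iSup₂ (f := fun (S : Finset W) (_ : IsShattered C S) => (S.card : ℕ∞))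
    _ hsh).trans hd
  rw [Finset.card_image_of_injOn hinj] at h
  exact_mod_cast h

/-- The growth function bound for a family of sets of finite Vapnik-Chervonenkis dimension. -/
theorem card_traces_le {C : Set (Set W)} {d : ℕ} (hd : vcDim C ≤ d) (s : ι → W)
    (hdm : d ≤ Fintype.card ι) (hm : 0 < Fintype.card ι) :
    ((traces C s).card : ℝ) ≤ Real.exp (d * (1 + Real.log (Fintype.card ι / d))) := by
  refine le_trans ?_ (sum_choose_le_exp hdm hm)
  -- Pajor's form of Sauer–Shelah: a family has at most as many members as sets that it shatters.
  have h1 := (Finset.card_le_card_shatterer (traces C s)).trans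
    Finset.card_shatterer_le_sum_vcDim
  have h2 : ∑ k ∈ Finset.Iic (traces C s).vcDim, (Fintype.card ι).choose k ≤
      ∑ k ∈ Finset.Iic d, (Fintype.card ι).choose k :=
    Finset.sum_le_sum_of_subset (Finset.Iic_subset_Iic.2 (vcDim_traces_le hd s))
  exact_mod_cast h1.trans h2

/-- The Rademacher average of a class of functions with two values of modulus at most one. -/
theorem sum_signs_iSup_le {𝓗 : Type*} [Nonempty 𝓗] (f : 𝓗 → W → ℝ) {u v : ℝ}
    (hu : |u| ≤ 1) (hv : |v| ≤ 1) (hf : ∀ h z, f h z = u ∨ f h z = v) {d : ℕ}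
    (hd : vcDim (Set.range fun h => f h ⁻¹' {v}) ≤ d)
    (hdm : d ≤ Fintype.card ι) (hm : 0 < Fintype.card ι) (b : ι → ℝ) (s : ι → W) :
    ∑ σ ∈ signs ι, ⨆ h, ∑ k, σ k * (b k * f h (s k)) ≤
      (signs ι).card *
        √(2 * (d * (1 + Real.log (Fintype.card ι / d))) * ∑ k, b k ^ 2) := by
  classical
  set C := Set.range fun h => f h ⁻¹' {v} with hC
  -- On the sample, a two-valued function is determined by its trace, so the supremum over the class
  -- is a maximum over finitely many vectors.
  let vec : Finset ι → ι → ℝ := fun T k => b k * if k ∈ T then v else u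
  have hvec : ∀ h, ∃ a ∈ (traces C s).image vec, ∀ k, b k * f h (s k) = a k := fun h => by
    have hT : (Finset.univ.filter fun k => s k ∈ f h ⁻¹' {v}) ∈ traces C s :=
      mem_traces.2 ⟨_, ⟨h, rfl⟩, fun k => ?_⟩
    refine ⟨_, Finset.mem_image_of_mem vec hT, fun k => ?_⟩
    rotate_left
    · simp
    · rcases eq_or_ne (f h (s k)) v with h1 | h1
      · simp [vec, h1]
      · have h2 := (hf h (s k)).resolve_right h1
        simp [vec, h2, show u ≠ v from h2 ▸ h1]
  refine sum_signs_le_of_finset ((traces C s).image vec) (fun a ha => ?_) (by positivity) ?_ ?_ _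
    fun σ _ => ?_
  · obtain ⟨T, -, rfl⟩ := Finset.mem_image.1 ha
    refine Finset.sum_le_sum fun k _ => ?_
    have : (if k ∈ T then v else u) ^ 2 ≤ 1 := by
      rw [sq_le_one_iff_abs_le_one]
      split_ifs <;> assumption
    simp only [vec, mul_pow]
    exact mul_le_of_le_one_right (sq_nonneg _) this
  · rcases Nat.eq_zero_or_pos d with rfl | hd0
    · simp
    have : (1 : ℝ) ≤ Fintype.card ι / d := by
      rw [one_le_div (by exact_mod_cast hd0)]
      exact_mod_cast hdm
    have := Real.log_nonneg this
    positivity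
  · exact le_trans (by exact_mod_cast Finset.card_image_le) (card_traces_le hd s hdm hm)
  · obtain ⟨a₀, ha₀, -⟩ := hvec (Classical.arbitrary 𝓗)
    obtain ⟨a, ha, hmax⟩ := Finset.exists_max_image ((traces C s).image vec)
      (fun a => ∑ k, σ k * a k) ⟨a₀, ha₀⟩
    refine ⟨a, ha, ciSup_le fun h => ?_⟩
    obtain ⟨a', ha', heq⟩ := hvec h
    simp only [heq]
    exact hmax a' ha'

end Sauer

/-! ### Symmetrization with a ghost sample -/

section Symmetrization

variable {ι W : Type*} [Fintype ι]

theorem iSup_mem_Icc {𝓗 : Type*} [Nonempty 𝓗] {F : 𝓗 → ℝ} {a b : ℝ}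
    (hF : ∀ h, F h ∈ Set.Icc a b) : ⨆ h, F h ∈ Set.Icc a b :=
  ⟨(hF (Classical.arbitrary 𝓗)).1.trans
    (le_ciSup (f := F) ⟨b, by rintro _ ⟨h, rfl⟩; exact (hF h).2⟩ (Classical.arbitrary 𝓗)),
    ciSup_le fun h => (hF h).2⟩

open Classical in
/-- The sample that takes its `k`-th point from the first sample if the `k`-th sign is positive,
and from the second one otherwise. -/
noncomputable def mixSample (σ : ι → ℝ) (p : (ι → W) × (ι → W)) : ι → W :=
  fun k => if σ k = 1 then p.1 k else p.2 k

/-- Holds because points of the same index in the two samples share a law, and each coordinate of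
the mixture is one of the two projections. -/
theorem measurePreserving_mixSample [MeasurableSpace W] (μ : ι → Measure W)
    [∀ k, IsProbabilityMeasure (μ k)] (σ : ι → ℝ) :
    MeasurePreserving (mixSample σ) ((Measure.pi μ).prod (Measure.pi μ)) (Measure.pi μ) := by
  classical
  have h1 := (measurePreserving_arrowProdEquivProdArrow W W ι μ μ).symm
  have h2 := measurePreserving_pi (fun k => (μ k).prod (μ k)) μ
    (f := fun k p => if σ k = 1 then p.1 else p.2) fun k => by
      split_ifs
      · exact measurePreserving_fst
      · exact measurePreserving_snd
  exact h2.comp h1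

/-- Splits the two-sample difference into two signed sums, each over one mixed sample. Their suprema
are then single-sample Rademacher suprema, the only ones assumed measurable. -/
theorem sum_mul_sub_eq_mixSample {σ : ι → ℝ} (hσ : ∀ k, σ k = -1 ∨ σ k = 1) (b : ι → ℝ)
    (f : W → ℝ) (p : (ι → W) × (ι → W)) :
    ∑ k, b k * (f (p.2 k) - f (p.1 k)) =
      ∑ k, σ k * (b k * f (mixSample (-σ) p k)) + ∑ k, (-σ) k * (b k * f (mixSample σ p k)) := by
  rw [← Finset.sum_add_distrib]
  refine Finset.sum_congr rfl fun k _ => ?_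
  rcases hσ k with h | h
  · have : (-1 : ℝ) ≠ 1 := by norm_num
    simp [mixSample, h, this]
    ring
  · have : (-1 : ℝ) ≠ 1 := by norm_num
    simp [mixSample, h, this]
    ring

variable [DecidableEq ι] [MeasurableSpace W]

/-- **Symmetrization**: the mean of the largest deviation is at most twice a bound on
the Rademacher averages. -/
theorem integral_iSup_deviation_le {𝓗 : Type*} [Nonempty 𝓗] (μ : ι → Measure W)
    [∀ k, IsProbabilityMeasure (μ k)] (f : 𝓗 → W → ℝ) (hfm : ∀ h, Measurable (f h))
    (hf : ∀ h z, |f h z| ≤ 1) (b : ι → ℝ) (ρ : ℝ)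
    (hdev : AEMeasurable (fun s => ⨆ h, (∑ k, b k * ∫ z, f h z ∂(μ k) - ∑ k, b k * f h (s k)))
      (Measure.pi μ))
    (hrad : ∀ σ ∈ signs ι, AEMeasurable (fun s => ⨆ h, ∑ k, σ k * (b k * f h (s k)))
      (Measure.pi μ))
    (hρ : ∀ s : ι → W, ∑ σ ∈ signs ι, ⨆ h, ∑ k, σ k * (b k * f h (s k)) ≤ (signs ι).card * ρ) :
    ∫ s, ⨆ h, (∑ k, b k * ∫ z, f h z ∂(μ k) - ∑ k, b k * f h (s k)) ∂(Measure.pi μ) ≤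
      2 * ρ := by
  set ν := Measure.pi μ with hν
  set D : (ι → W) → ℝ := fun s => ⨆ h, (∑ k, b k * ∫ z, f h z ∂(μ k) - ∑ k, b k * f h (s k))
    with hD
  set R : (ι → ℝ) → (ι → W) → ℝ := fun σ s => ⨆ h, ∑ k, σ k * (b k * f h (s k)) with hR
  set S := ∑ k, |b k| with hS
  have hsign : ∀ σ ∈ signs ι, ∀ h (s : ι → W), ∑ k, σ k * (b k * f h (s k)) ∈ Set.Icc (-S) S := by
    intro σ hσ h s
    rw [Set.mem_Icc, ← abs_le]
    refine (Finset.abs_sum_le_sum_abs _ _).trans (Finset.sum_le_sum fun k _ => ?_)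
    have h1 : |σ k| = 1 := by
      rcases mem_signs.1 hσ k with h | h <;> simp [h]
    rw [abs_mul, abs_mul, h1, one_mul]
    exact mul_le_of_le_one_right (abs_nonneg _) (hf _ _)
  have hRS : ∀ σ ∈ signs ι, ∀ s, R σ s ∈ Set.Icc (-S) S :=
    fun σ hσ s => iSup_mem_Icc fun h => hsign σ hσ h s
  have hle : ∀ σ ∈ signs ι, ∀ h (s : ι → W), ∑ k, σ k * (b k * f h (s k)) ≤ R σ s := fun σ hσ h s =>
    le_ciSup (f := fun h => ∑ k, σ k * (b k * f h (s k)))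
      ⟨S, by rintro _ ⟨h, rfl⟩; exact (hsign σ hσ h s).2⟩ h
  have hRi : ∀ σ ∈ signs ι, Integrable (R σ) ν := fun σ hσ =>
    .of_mem_Icc (-S) S (hrad σ hσ) (.of_forall (hRS σ hσ))
  have hmix : ∀ σ ∈ signs ι, ∀ τ, Integrable (fun p => R σ (mixSample τ p)) (ν.prod ν) :=
    fun σ hσ τ => (measurePreserving_mixSample μ τ).integrable_comp_of_integrable (hRi σ hσ)
  have hmixint : ∀ σ ∈ signs ι, ∀ τ, ∫ p, R σ (mixSample τ p) ∂(ν.prod ν) = ∫ s, R σ s ∂ν := by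
    intro σ hσ τ
    have hmp := measurePreserving_mixSample μ τ
    have := integral_map (f := R σ) hmp.measurable.aemeasurable
      (by rw [hmp.map_eq]; exact (hrad σ hσ).aestronglyMeasurable)
    rw [hmp.map_eq] at this
    exact this.symm
  set G : (ι → W) × (ι → W) → ℝ := fun p =>
    ∑ σ ∈ signs ι, (R σ (mixSample (-σ) p) + R (-σ) (mixSample σ p)) with hG
  have hGi : Integrable G (ν.prod ν) := integrable_finsetSum _ fun σ hσ =>
    (hmix σ hσ _).add (hmix _ (neg_mem_signs.2 hσ) _)
  have hpos := card_signs_pos (ι := ι)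
  have hGle : ∀ h p, (signs ι).card * ∑ k, b k * (f h (p.2 k) - f h (p.1 k)) ≤ G p := by
    intro h p
    rw [← nsmul_eq_mul, ← Finset.sum_const]
    refine Finset.sum_le_sum fun σ hσ => ?_
    rw [sum_mul_sub_eq_mixSample (mem_signs.1 hσ)]
    exact add_le_add (hle σ hσ h _) (hle (-σ) (neg_mem_signs.2 hσ) h _)
  have hfi : ∀ h k, Integrable (fun s : ι → W => f h (s k)) ν := fun h k =>
    .of_mem_Icc (-1) 1 ((hfm h).comp (measurable_pi_apply k)).aemeasurable
      (.of_forall fun s => abs_le.1 (hf _ _))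
  -- The risk is the mean over the ghost sample. `G` dominates the difference for every `h`, so the
  -- supremum is taken only after integrating, and no supremum over pairs of samples has to be
  -- measurable.
  have hDle : ∀ᵐ s ∂ν, (signs ι).card * D s ≤ ∫ s', G (s, s') ∂ν := by
    filter_upwards [hGi.prod_right_ae] with s hs
    rw [← le_div_iff₀' hpos]
    refine ciSup_le fun h => ?_
    rw [le_div_iff₀' hpos]
    have hi : Integrable (fun s' : ι → W => ∑ k, b k * (f h (s' k) - f h (s k))) ν :=
      integrable_finsetSum _ fun k _ => ((hfi h k).sub (integrable_const _)).const_mul _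
    calc _ = ∫ s', (signs ι).card * ∑ k, b k * (f h (s' k) - f h (s k)) ∂ν := by
          have hik : ∀ k ∈ Finset.univ,
              Integrable (fun s' : ι → W => b k * (f h (s' k) - f h (s k))) ν :=
            fun k _ => ((hfi h k).sub (integrable_const _)).const_mul _
          rw [integral_const_mul, integral_finsetSum _ hik, ← Finset.sum_sub_distrib]
          congr 1
          refine Finset.sum_congr rfl fun k _ => ?_
          rw [integral_const_mul, integral_sub (hfi h k) (integrable_const _), mul_sub]
          have : ∫ s', f h (s' k) ∂ν = ∫ z, f h z ∂(μ k) := by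
            have hmp := measurePreserving_eval μ k
            rw [← hmp.map_eq, integral_map hmp.measurable.aemeasurable
              (hfm h).aestronglyMeasurable]
          simp [this]
      _ ≤ ∫ s', G (s, s') ∂ν :=
          integral_mono (hi.const_mul _) hs fun s' => hGle h (s, s')
  have hDi : Integrable D ν := by
    refine .of_mem_Icc (-S - S) (S + S) hdev (.of_forall fun s => iSup_mem_Icc fun h => ?_)
    have h1 : |∑ k, b k * ∫ z, f h z ∂(μ k)| ≤ S := by
      refine (Finset.abs_sum_le_sum_abs _ _).trans (Finset.sum_le_sum fun k _ => ?_)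
      rw [abs_mul]
      refine mul_le_of_le_one_right (abs_nonneg _) ?_
      have := norm_integral_le_of_norm_le_const (μ := μ k) (f := f h) (C := 1)
        (.of_forall fun z => hf h z)
      simpa using this
    have h2 := hsign (fun _ => 1) (mem_signs.2 fun _ => .inr rfl) h s
    simp only [one_mul] at h2
    have h3 := abs_le.1 h1
    exact ⟨by linarith [h2.2, h3.1], by linarith [h2.1, h3.2]⟩
  have hsum : ∑ σ ∈ signs ι, ∫ s, R σ s ∂ν ≤ (signs ι).card * ρ := by
    rw [← integral_finsetSum _ hRi]
    calc _ ≤ ∫ _, (signs ι).card * ρ ∂ν :=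
          integral_mono (integrable_finsetSum _ hRi) (integrable_const _) hρ
      _ = _ := by simp
  have hfin : (signs ι).card * ∫ s, D s ∂ν ≤ (signs ι).card * (2 * ρ) := by
    calc (signs ι).card * ∫ s, D s ∂ν = ∫ s, (signs ι).card * D s ∂ν :=
          (integral_const_mul _ _).symm
      _ ≤ ∫ s, ∫ s', G (s, s') ∂ν ∂ν :=
          integral_mono_ae (hDi.const_mul _) hGi.integral_prod_left hDle
      _ = ∫ p, G p ∂(ν.prod ν) := (integral_prod _ hGi).symm
      _ = ∑ σ ∈ signs ι, (∫ s, R σ s ∂ν + ∫ s, R (-σ) s ∂ν) := by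
          have hσi : ∀ σ ∈ signs ι, Integrable
              (fun p => R σ (mixSample (-σ) p) + R (-σ) (mixSample σ p)) (ν.prod ν) :=
            fun σ hσ => (hmix σ hσ _).add (hmix _ (neg_mem_signs.2 hσ) _)
          rw [integral_finsetSum _ hσi]
          refine Finset.sum_congr rfl fun σ hσ => ?_
          rw [integral_add (hmix σ hσ _) (hmix _ (neg_mem_signs.2 hσ) _), hmixint σ hσ,
            hmixint _ (neg_mem_signs.2 hσ)]
      _ = 2 * ∑ σ ∈ signs ι, ∫ s, R σ s ∂ν := by
          rw [Finset.sum_add_distrib, sum_signs_neg fun σ => ∫ s, R σ s ∂ν, two_mul]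
      _ ≤ _ := by linarith
  exact le_of_mul_le_mul_left hfin hpos

end Symmetrization

/-! ### The deviation bound for one weight vector -/

section Deviation

variable {ι W : Type*} [Fintype ι] [DecidableEq ι] [MeasurableSpace W]

/-- The tail of the largest deviation of weighted averages over a class of functions with two
values and finite Vapnik-Chervonenkis dimension. -/
theorem measureReal_exists_deviation_ge_le {𝓗 : Type*} [Nonempty 𝓗] (μ : ι → Measure W)
    [∀ k, IsProbabilityMeasure (μ k)] (f : 𝓗 → W → ℝ) (hfm : ∀ h, Measurable (f h))
    {u v M : ℝ} (huv : u < v) (hu : |u| ≤ 1) (hv : |v| ≤ 1) (hM : v - u ≤ M)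
    (hf : ∀ h z, f h z = u ∨ f h z = v) {d : ℕ}
    (hd : vcDim (Set.range fun h => f h ⁻¹' {v}) ≤ d)
    (hdm : d ≤ Fintype.card ι) (hm : 0 < Fintype.card ι) (b : ι → ℝ) {Q : ℝ}
    (hQ : ∑ k, b k ^ 2 ≤ Q)
    (hdev : AEMeasurable (fun s => ⨆ h, (∑ k, b k * ∫ z, f h z ∂(μ k) - ∑ k, b k * f h (s k)))
      (Measure.pi μ))
    (hrad : ∀ σ ∈ signs ι, AEMeasurable (fun s => ⨆ h, ∑ k, σ k * (b k * f h (s k)))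
      (Measure.pi μ)) {t : ℝ} (ht : 0 ≤ t) :
    (Measure.pi μ).real {s | ∃ h, 2 * √(2 * (d * (1 + Real.log (Fintype.card ι / d))) * Q) + t ≤
      ∑ k, b k * ∫ z, f h z ∂(μ k) - ∑ k, b k * f h (s k)} ≤
        Real.exp (-t ^ 2 / (M ^ 2 * Q / 2)) := by
  set ν := Measure.pi μ with hν
  set D : (ι → W) → ℝ := fun s => ⨆ h, (∑ k, b k * ∫ z, f h z ∂(μ k) - ∑ k, b k * f h (s k))
    with hD
  have hf1 : ∀ h z, |f h z| ≤ 1 := fun h z => by rcases hf h z with h | h <;> rw [h] <;> assumption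
  have hQ0 : 0 ≤ Q := (Finset.sum_nonneg fun k _ => sq_nonneg (b k)).trans hQ
  have hlog : 0 ≤ (d : ℝ) * (1 + Real.log (Fintype.card ι / d)) := by
    rcases Nat.eq_zero_or_pos d with rfl | hd0
    · simp
    have : (1 : ℝ) ≤ Fintype.card ι / d := by
      rw [one_le_div (by exact_mod_cast hd0)]
      exact_mod_cast hdm
    have := Real.log_nonneg this
    positivity
  have hmean : ∫ s, D s ∂ν ≤ 2 * √(2 * (d * (1 + Real.log (Fintype.card ι / d))) * Q) :=
    integral_iSup_deviation_le μ f hfm hf1 b _ hdev hrad fun s =>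
      (sum_signs_iSup_le f hu hv hf hd hdm hm b s).trans (by gcongr)
  set S := ∑ k, |b k| with hS
  have hdS : ∀ h (s : ι → W), ∑ k, b k * ∫ z, f h z ∂(μ k) - ∑ k, b k * f h (s k) ∈
      Set.Icc (-S - S) (S + S) := fun h s => by
    have h1 : |∑ k, b k * ∫ z, f h z ∂(μ k)| ≤ S := by
      refine (Finset.abs_sum_le_sum_abs _ _).trans (Finset.sum_le_sum fun k _ => ?_)
      rw [abs_mul]
      refine mul_le_of_le_one_right (abs_nonneg _) ?_
      have := norm_integral_le_of_norm_le_const (μ := μ k) (f := f h) (C := 1)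
        (.of_forall fun z => hf1 h z)
      simpa using this
    have h2 : |∑ k, b k * f h (s k)| ≤ S := by
      refine (Finset.abs_sum_le_sum_abs _ _).trans (Finset.sum_le_sum fun k _ => ?_)
      rw [abs_mul]
      exact mul_le_of_le_one_right (abs_nonneg _) (hf1 _ _)
    rw [abs_le] at h1 h2
    exact ⟨by linarith [h2.2, h1.1], by linarith [h2.1, h1.2]⟩
  have hDle : ∀ h s, ∑ k, b k * ∫ z, f h z ∂(μ k) - ∑ k, b k * f h (s k) ≤ D s := fun h s =>
    le_ciSup (f := fun h => ∑ k, b k * ∫ z, f h z ∂(μ k) - ∑ k, b k * f h (s k))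
      ⟨S + S, by rintro _ ⟨h, rfl⟩; exact (hdS h s).2⟩ h
  have hdiff : ∀ s k z, D s - D (Function.update s k z) ≤ |b k| * M := fun s k z => by
    suffices D s ≤ |b k| * M + D (Function.update s k z) by linarith
    refine ciSup_le fun h => ?_
    have h1 := hDle h (Function.update s k z)
    have h2 : ∑ l, b l * f h (Function.update s k z l) - ∑ l, b l * f h (s l) =
        b k * (f h z - f h (s k)) := by
      rw [← Finset.sum_sub_distrib, Finset.sum_eq_single k]
      · simp; ring
      · intro l _ hl
        simp [Function.update_of_ne hl]
      · simp
    have h3 : b k * (f h z - f h (s k)) ≤ |b k| * M := by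
      refine (le_abs_self _).trans ?_
      rw [abs_mul]
      gcongr
      rw [abs_le]
      rcases hf h z with h | h <;> rcases hf ‹_› (s k) with h' | h' <;> rw [h, h'] <;>
        constructor <;> linarith
    linarith
  -- The variance proxy is a quarter of the sum of the squares `(|b k| * M) ^ 2`, with `∑ b k ^ 2`
  -- enlarged to `Q`.
  have hV0 : 0 ≤ M ^ 2 * Q / 4 := by positivity
  have hsub := hasSubgaussianMGF_of_boundedDifferences μ D (-S - S) (S + S)
    (fun k => |b k| * M) (M ^ 2 * Q / 4).toNNReal (by
      simp only [mul_pow, sq_abs, ← Finset.sum_mul, Real.coe_toNNReal _ hV0]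
      nlinarith [sq_nonneg M]) hdev (fun s => iSup_mem_Icc fun h => hdS h s) hdiff
  have htail := hsub.measure_ge_le ht
  have hVeq : 2 * (M ^ 2 * Q / 4) = M ^ 2 * Q / 2 := by ring
  rw [Real.coe_toNNReal _ hV0, hVeq] at htail
  refine (measureReal_mono (fun s hs => ?_) (measure_ne_top _ _)).trans htail
  obtain ⟨h, hs⟩ := hs
  have := hDle h s
  rw [Set.mem_ofPred_eq]
  linarith

end Deviation

/-! ### Skewness, the net of weights and the Lipschitz estimate -/

section Weights

variable {n : ℕ}

/-- Expanding the square, the cross term is fixed by `∑ w i = 1` and cancels the added 1. -/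
theorem skewness_eq (hn : n ≠ 0) {w : Fin n → ℝ} (hw : ∑ i, w i = 1) :
    skewness w = n * ∑ i, w i ^ 2 := by
  have hn' : (n : ℝ) ≠ 0 := by exact_mod_cast hn
  have : ∑ i, |w i - 1 / n| ^ 2 = ∑ i, w i ^ 2 - 1 / n := by
    have h : ∀ i, |w i - 1 / n| ^ 2 = w i ^ 2 - 2 / n * w i + 1 / n ^ 2 := fun i => by
      rw [sq_abs]; ring
    simp_rw [h]
    rw [Finset.sum_add_distrib, Finset.sum_sub_distrib, ← Finset.mul_sum, hw]
    simp
    field_simp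
    ring
  rw [skewness, this]
  field_simp
  ring

theorem isCompact_integratedSet (φ : ℝ) {A B : Set (Fin n → ℝ)} (hA : IsCompact A)
    (hB : IsCompact B) : IsCompact (integratedSet φ A B) := by
  have h := (hA.prod hB).image
    (f := fun p : (Fin n → ℝ) × (Fin n → ℝ) => (1 / (1 - φ)) • (p.1 - φ • p.2)) (by fun_prop)
  convert h using 1
  ext w
  simp only [integratedSet, Set.mem_ofPred_eq, Set.mem_image, Set.mem_prod, Prod.exists]
  exact ⟨fun ⟨a, ha, b, hb, h⟩ => ⟨a, b, ⟨ha, hb⟩, h.symm⟩,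
    fun ⟨a, b, ⟨ha, hb⟩, h⟩ => ⟨a, ha, b, hb, h.symm⟩⟩

theorem sum_eq_one_of_mem_integratedSet {φ : ℝ} (hφ : φ < 1) {A B : Set (Fin n → ℝ)}
    (hA : A ⊆ stdSimplex ℝ (Fin n)) (hB : B ⊆ stdSimplex ℝ (Fin n)) {w : Fin n → ℝ}
    (hw : w ∈ integratedSet φ A B) : ∑ i, w i = 1 := by
  obtain ⟨a, ha, b, hb, rfl⟩ := hw
  have : 1 - φ ≠ 0 := by linarith
  simp only [Pi.smul_apply, Pi.sub_apply, smul_eq_mul, ← Finset.mul_sum,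
    Finset.sum_sub_distrib, (hA ha).2, (hB hb).2]
  field_simp

theorem skewness_le_setSkewness {L : Set (Fin n → ℝ)} (hL : IsCompact L) {w : Fin n → ℝ}
    (hw : w ∈ L) : skewness w ≤ setSkewness L := by
  refine le_csSup (hL.image ?_).bddAbove ⟨w, hw, rfl⟩
  unfold skewness
  fun_prop

/-- A compact set of weight vectors has an optimal finite `ℓ¹` net. -/
theorem exists_finset_l1_net {L : Set (Fin n → ℝ)} (hL : IsCompact L) {ε : ℝ} (hε : 0 < ε) :
    ∃ T : Finset (Fin n → ℝ), ↑T ⊆ L ∧ T.card = (l1CoveringNumber L ε).toNat ∧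
      ∀ w ∈ L, ∃ w' ∈ T, ∑ i, |w i - w' i| ≤ ε := by
  classical
  set L' := (WithLp.toLp 1 : (Fin n → ℝ) → PiLp 1 fun _ => ℝ) '' L with hL'
  have hc : IsCompact L' := hL.image (PiLp.continuous_toLp 1 _)
  have hne : Metric.coveringNumber ε.toNNReal L' ≠ ⊤ := by
    obtain ⟨t, htL, htf, ht⟩ := Metric.exists_finite_isCover_of_isCompact
      (Real.toNNReal_pos.2 hε).ne' hc
    exact ne_top_of_le_ne_top htf.encard_lt_top.ne (ht.coveringNumber_le_encard htL)
  have hfin : (Metric.minimalCover ε.toNNReal L').Finite := Metric.finite_minimalCover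
  refine ⟨hfin.toFinset.image WithLp.ofLp, ?_, ?_, fun w hw => ?_⟩
  · intro w hw
    obtain ⟨p, hp, rfl⟩ := Finset.mem_image.1 (Finset.mem_coe.1 hw)
    obtain ⟨w', hw', rfl⟩ := Metric.minimalCover_subset (hfin.mem_toFinset.1 hp)
    exact hw'
  -- The covering number is finite by compactness and attained by the minimal cover, so `toNat`
  -- loses nothing.
  · rw [Finset.card_image_of_injective _ (WithLp.ofLp_injective 1), l1CoveringNumber,
      ← Metric.encard_minimalCover hne, hfin.encard_eq_coe_toFinset_card]
    simp
  · obtain ⟨p, hp, hwp⟩ := Metric.isCover_minimalCover hne (Set.mem_image_of_mem _ hw)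
    refine ⟨WithLp.ofLp p, Finset.mem_image_of_mem _ (hfin.mem_toFinset.2 hp), ?_⟩
    replace hwp : edist (WithLp.toLp 1 w) p ≤ ENNReal.ofReal ε := hwp
    rw [edist_dist] at hwp
    have h := (ENNReal.ofReal_le_ofReal_iff hε.le).1 hwp
    rw [PiLp.dist_eq_of_L1] at h
    simpa [Real.dist_eq] using h

variable {X Y X' : Type*} {N : ℕ}

theorem empRisk_eq_sum (s : Fin n × Fin N → X × Y) (ℓ : X' × Y → ℝ) (w : Fin n → ℝ)
    (h : X → X') :
    empRisk s ℓ w h = ∑ k : Fin n × Fin N, w k.1 / N * ℓ (h (s k).1, (s k).2) := by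
  simp only [empRisk, Fintype.sum_prod_type, Finset.mul_sum]

theorem risk_eq_sum [MeasurableSpace X] [MeasurableSpace Y] (hN : N ≠ 0)
    (P : Fin n → Measure (X × Y)) (ℓ : X' × Y → ℝ) (w : Fin n → ℝ) (h : X → X') :
    risk P ℓ w h = ∑ k : Fin n × Fin N, w k.1 / N * ∫ z, ℓ (h z.1, z.2) ∂(P k.1) := by
  have hN' : (N : ℝ) ≠ 0 := by exact_mod_cast hN
  simp only [risk, Fintype.sum_prod_type, Finset.sum_const, Finset.card_univ, Fintype.card_fin,
    nsmul_eq_mul]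
  refine Finset.sum_congr rfl fun i _ => ?_
  field_simp

theorem sum_weight_sq_eq (hn : n ≠ 0) (hN : N ≠ 0) {w : Fin n → ℝ} (hw : ∑ i, w i = 1) :
    ∑ k : Fin n × Fin N, (w k.1 / N) ^ 2 = skewness w / (N * n) := by
  have hN' : (N : ℝ) ≠ 0 := by exact_mod_cast hN
  have hn' : (n : ℝ) ≠ 0 := by exact_mod_cast hn
  rw [skewness_eq hn hw]
  simp only [Fintype.sum_prod_type, Finset.sum_const, Finset.card_univ, Fintype.card_fin,
    nsmul_eq_mul, div_pow, ← Finset.mul_sum, ← Finset.sum_div]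
  field_simp

/-- The generalization gap is Lipschitz in the weights for the norm `‖x‖₁`. -/
theorem risk_sub_empRisk_le [MeasurableSpace X] [MeasurableSpace Y] [MeasurableSpace X']
    (hN : N ≠ 0) (P : Fin n → Measure (X × Y)) [∀ i, IsProbabilityMeasure (P i)]
    {ℓ : X' × Y → ℝ} (hℓ : Measurable ℓ) {u v M ε : ℝ} (huv : u ≤ v) (hM : v - u ≤ M)
    (hℓuv : ∀ p, ℓ p ∈ Set.Icc u v) {h : X → X'} (hh : Measurable h)
    (s : Fin n × Fin N → X × Y) {w w' : Fin n → ℝ} (hw : ∑ i, |w i - w' i| ≤ ε) :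
    risk P ℓ w h - empRisk s ℓ w h ≤ risk P ℓ w' h - empRisk s ℓ w' h + M * ε := by
  have hN' : (0 : ℝ) < N := by exact_mod_cast Nat.pos_of_ne_zero hN
  set I : Fin n → ℝ := fun i => ∫ z, ℓ (h z.1, z.2) ∂(P i)
  set a : Fin n → ℝ := fun i => (∑ j, ℓ (h (s (i, j)).1, (s (i, j)).2)) / N
  have hI : ∀ i, I i ∈ Set.Icc u v := fun i => by
    have hi : Integrable (fun z : X × Y => ℓ (h z.1, z.2)) (P i) :=
      .of_mem_Icc u v (by fun_prop) (.of_forall fun z => hℓuv _)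
    have h1 := integral_mono (integrable_const u) hi fun z => (hℓuv _).1
    have h2 := integral_mono hi (integrable_const v) fun z => (hℓuv _).2
    simp only [integral_const, probReal_univ, one_smul] at h1 h2
    exact ⟨h1, h2⟩
  have ha : ∀ i, a i ∈ Set.Icc u v := fun i => by
    have h1 := Finset.card_nsmul_le_sum Finset.univ
      (fun j : Fin N => ℓ (h (s (i, j)).1, (s (i, j)).2)) u fun j _ => (hℓuv _).1
    have h2 := Finset.sum_le_card_nsmul Finset.univ
      (fun j : Fin N => ℓ (h (s (i, j)).1, (s (i, j)).2)) v fun j _ => (hℓuv _).2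
    simp only [Finset.card_univ, Fintype.card_fin, nsmul_eq_mul] at h1 h2
    exact ⟨(le_div_iff₀' hN').2 h1, (div_le_iff₀' hN').2 h2⟩
  -- `I i` and `a i` are both averages of values in `[u, v]`, so they differ by at most `M`, not `2
  -- * M`.
  have hgap : ∀ w : Fin n → ℝ, risk P ℓ w h - empRisk s ℓ w h = ∑ i, w i * (I i - a i) := by
    intro w
    simp only [risk, empRisk, ← Finset.sum_sub_distrib]
    exact Finset.sum_congr rfl fun i _ => by simp only [I, a]; ring
  rw [hgap, hgap, ← sub_le_iff_le_add', ← Finset.sum_sub_distrib]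
  calc ∑ i, (w i * (I i - a i) - w' i * (I i - a i)) ≤ ∑ i, |w i - w' i| * M := by
        refine Finset.sum_le_sum fun i _ => ?_
        rw [← sub_mul]
        refine (le_abs_self _).trans ?_
        rw [abs_mul]
        gcongr
        have h1 := hI i
        have h2 := ha i
        rw [abs_le]
        constructor <;> linarith [h1.1, h1.2, h2.1, h2.2]
    _ = M * ∑ i, |w i - w' i| := by rw [← Finset.sum_mul, mul_comm]
    _ ≤ M * ε := by
      have : 0 ≤ M := by linarith
      gcongr

end Weights

end FairFL

/-! ### The union bound over the net -/

theorem theorem4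
    {X Y X' Ω : Type*} [MeasurableSpace X] [MeasurableSpace Y] [MeasurableSpace X']
    [MeasurableSpace Ω]
    -- the clients, the number of data points of each client, and the data distributions
    (n N : ℕ) (P : Fin n → Measure (X × Y)) [∀ i, IsProbabilityMeasure (P i)]
    -- the hypotheses
    (H : Set (X → X')) (hH : ∀ h ∈ H, Measurable h)
    -- the loss: two values of modulus at most one (such as -1 and 1), at most `M` apart
    (ℓ : X' × Y → ℝ) (hℓ : Measurable ℓ) (u v M : ℝ) (huv : u < v)
    (hu : |u| ≤ 1) (hv : |v| ≤ 1) (hM : v - u ≤ M) (hℓuv : ∀ p, ℓ p = u ∨ ℓ p = v)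
    -- the ambiguity sets
    (φ : ℝ) (hφ0 : 0 ≤ φ) (hφ1 : φ < 1) (A B : Set (Fin n → ℝ))
    (hA : A ⊆ stdSimplex ℝ (Fin n)) (hAc : IsCompact A) (hAne : A.Nonempty)
    (hB : B ⊆ stdSimplex ℝ (Fin n)) (hBc : IsCompact B) (hBne : B.Nonempty)
    -- the Vapnik-Chervonenkis dimension of the loss class
    (d : ℕ) (hd : FairFL.binaryVCDim v (FairFL.lossClass ℓ H) = d) (hdN : d < N * n)
    -- suprema over the hypotheses are random variables
    (hsup : FairFL.HasMeasurableSuprema N P ℓ H (FairFL.integratedSet φ A B))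
    -- the data
    (μ : Measure Ω) [IsProbabilityMeasure μ] (Z : Fin n × Fin N → Ω → X × Y)
    (hZ : ∀ k, Measurable (Z k)) (hZindep : iIndepFun Z μ)
    (hZlaw : ∀ i j, μ.map (Z (i, j)) = P i)
    (ε : ℝ) (hε : 0 < ε) (δ : ℝ) (hδ : 0 < δ) :
    ∃ E : Set Ω, MeasurableSet E ∧ ENNReal.ofReal (1 - δ) ≤ μ E ∧
      ∀ ω ∈ E, ∀ h ∈ H, ∀ w ∈ FairFL.integratedSet φ A B,
        FairFL.risk P ℓ w h ≤ FairFL.empRisk (fun k => Z k ω) ℓ w h + M * ε +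
          √(FairFL.setSkewness (FairFL.integratedSet φ A B) / (2 * (N * n))) *
            (4 * √d * √(1 + Real.log ((N * n) / d)) +
              M * √(Real.log
                ((FairFL.l1CoveringNumber (FairFL.integratedSet φ A B) ε).toNat / δ))) := by
  -- For `δ ≥ 1` the empty event suffices; below, `δ < 1` makes the logarithm nonnegative.
  rcases le_or_gt 1 δ with hδ1 | hδ1
  · exact ⟨∅, .empty, by simp [ENNReal.ofReal_of_nonpos (sub_nonpos.2 hδ1)], by simp⟩
  rcases H.eq_empty_or_nonempty with rfl | hHne
  · exact ⟨Set.univ, .univ, by simp [hδ.le], by simp⟩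
  have hN : N ≠ 0 := by rintro rfl; simp at hdN
  have hn : n ≠ 0 := by rintro rfl; simp at hdN
  have hN' : (0 : ℝ) < N := by exact_mod_cast Nat.pos_of_ne_zero hN
  have hn' : (0 : ℝ) < n := by exact_mod_cast Nat.pos_of_ne_zero hn
  have : Nonempty H := hHne.to_subtype
  have hM0 : 0 < M := by linarith
  set L := FairFL.integratedSet φ A B with hLdef
  have hLc : IsCompact L := FairFL.isCompact_integratedSet φ hAc hBc
  have hsum : ∀ w ∈ L, ∑ i, w i = 1 :=
    fun w hw => FairFL.sum_eq_one_of_mem_integratedSet hφ1 hA hB hw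
  obtain ⟨w₀, hw₀⟩ : L.Nonempty :=
    ⟨_, hAne.some, hAne.some_mem, hBne.some, hBne.some_mem, rfl⟩
  obtain ⟨T, hTL, hTcard, hTnet⟩ := FairFL.exists_finset_l1_net hLc hε
  rw [← hTcard]
  have hT0 : (0 : ℝ) < T.card := by
    obtain ⟨w, hw, -⟩ := hTnet w₀ hw₀
    exact_mod_cast Finset.card_pos.2 ⟨w, hw⟩
  have hT1 : (1 : ℝ) ≤ T.card := by exact_mod_cast (Nat.cast_pos.1 hT0)
  -- One bound on the sum of squares serves all weights, so every net point has the same threshold.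
  set Q : ℝ := FairFL.setSkewness L / (N * n) with hQ
  have hQw : ∀ w ∈ L, ∑ k : Fin n × Fin N, (w k.1 / N) ^ 2 ≤ Q := fun w hw => by
    rw [FairFL.sum_weight_sq_eq hn hN (hsum w hw), hQ]
    gcongr
    exact FairFL.skewness_le_setSkewness hLc hw
  have hQ0 : 0 < Q := by
    have h1 : 1 ≤ FairFL.skewness w₀ := by
      rw [FairFL.skewness]
      have : 0 ≤ n * ∑ i, |w₀ i - 1 / n| ^ 2 := by positivity
      linarith
    have := FairFL.skewness_le_setSkewness hLc hw₀
    have : 0 < FairFL.setSkewness L := by linarith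
    positivity
  set lg := Real.log (T.card / δ) with hlg
  have hlg0 : 0 ≤ lg := Real.log_nonneg ((one_le_div hδ).2 (by linarith))
  -- Chosen so that the tail `exp (-t ^ 2 / (M ^ 2 * Q / 2))` equals `δ / T.card`, the share of one
  -- net point.
  set t := √(Q / 2) * (M * √lg) with ht
  have ht0 : 0 ≤ t := by positivity
  have hcard : ((Fintype.card (Fin n × Fin N) : ℕ) : ℝ) = N * n := by simp [mul_comm]
  set D := (d : ℝ) * (1 + Real.log (N * n / d)) with hD
  set ν := FairFL.sampleLaw N P with hν
  have : IsProbabilityMeasure ν := by rw [hν, FairFL.sampleLaw]; infer_instance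
  set bad : (Fin n → ℝ) → Set (Fin n × Fin N → X × Y) := fun w =>
    {s | ∃ h : H, 2 * √(2 * D * Q) + t ≤ FairFL.risk P ℓ w h.1 - FairFL.empRisk s ℓ w h.1}
    with hbad
  have hbadle : ∀ w ∈ L, ν.real (bad w) ≤ δ / T.card := by
    intro w hw
    have hC : Set.range (fun h : H => (fun z : X × Y => ℓ (h.1 z.1, z.2)) ⁻¹' {v}) =
        (fun g => g ⁻¹' {v}) '' FairFL.lossClass ℓ H := by
      ext c
      simp only [Set.mem_range, Set.mem_image, FairFL.lossClass, Set.mem_ofPred_eq]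
      exact ⟨fun ⟨h, hc⟩ => ⟨_, ⟨h.1, h.2, rfl⟩, hc⟩,
        fun ⟨_, ⟨h, hh, hg⟩, hc⟩ => ⟨⟨h, hh⟩, by rw [← hc, hg]⟩⟩
    have hdev := hsup.excess w hw
    simp only [FairFL.risk_eq_sum hN, FairFL.empRisk_eq_sum] at hdev
    have hrad : ∀ σ ∈ FairFL.signs (Fin n × Fin N), AEMeasurable
        (fun s : Fin n × Fin N → X × Y =>
          ⨆ h : H, ∑ k, σ k * (w k.1 / N * ℓ (h.1 (s k).1, (s k).2)))
        (FairFL.sampleLaw N P) := fun σ hσ => by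
      convert hsup.signed w hw σ (FairFL.mem_signs.1 hσ) using 4 with s h
      simp only [Fintype.sum_prod_type, Finset.mul_sum]
      exact Finset.sum_congr rfl fun i _ => Finset.sum_congr rfl fun j _ => by ring
    have h := FairFL.measureReal_exists_deviation_ge_le (fun k : Fin n × Fin N => P k.1)
      (fun (h : H) (z : X × Y) => ℓ (h.1 z.1, z.2))
      (fun h => hℓ.comp (((hH h.1 h.2).comp measurable_fst).prodMk measurable_snd))
      huv hu hv hM (fun h z => hℓuv _) (d := d) (by rw [hC]; exact hd.le)
      (by simp only [Fintype.card_prod, Fintype.card_fin]; rw [mul_comm]; exact hdN.le)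
      (by simp only [Fintype.card_prod, Fintype.card_fin]; positivity)
      (fun k => w k.1 / N) (hQw w hw) hdev hrad ht0
    rw [hcard] at h
    simp only [hbad, FairFL.risk_eq_sum hN, FairFL.empRisk_eq_sum]
    refine h.trans (le_of_eq ?_)
    have : -t ^ 2 / (M ^ 2 * Q / 2) = -lg := by
      rw [ht, mul_pow, mul_pow, Real.sq_sqrt (by positivity), Real.sq_sqrt hlg0]
      field_simp
    rw [this, Real.exp_neg, hlg, Real.exp_log (by positivity), inv_div]
  set U := ⋃ w ∈ T, bad w with hU
  have hUle : ν.real U ≤ δ := by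
    calc ν.real U ≤ ∑ w ∈ T, ν.real (bad w) := measureReal_biUnion_finset_le _ _
      _ ≤ ∑ _w ∈ T, δ / T.card := Finset.sum_le_sum fun w hw => hbadle w (hTL hw)
      _ = δ := by rw [Finset.sum_const, nsmul_eq_mul]; field_simp
  have hZm : Measurable fun ω k => Z k ω := measurable_pi_lambda _ hZ
  have hlaw : μ.map (fun ω k => Z k ω) = ν := by
    rw [(iIndepFun_iff_map_fun_eq_pi_map fun k => (hZ k).aemeasurable).1 hZindep, hν,
      FairFL.sampleLaw]
    congr 1
    funext k
    exact hZlaw k.1 k.2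
  -- The bad set is a union over a possibly uncountable class and need not be measurable; its
  -- measurable hull has the same measure.
  refine ⟨(fun ω k => Z k ω) ⁻¹' (toMeasurable ν U)ᶜ,
    hZm (measurableSet_toMeasurable ν U).compl, ?_, fun ω hω h hh w hw => ?_⟩
  · rw [← Measure.map_apply hZm (measurableSet_toMeasurable ν U).compl, hlaw,
      prob_compl_eq_one_sub (measurableSet_toMeasurable ν U), measure_toMeasurable,
      ENNReal.ofReal_sub _ hδ.le, ENNReal.ofReal_one]
    gcongr
    exact (ENNReal.le_ofReal_iff_toReal_le (measure_ne_top _ _) hδ.le).2 hUle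
  · obtain ⟨w', hw'T, hww'⟩ := hTnet w hw
    have hgood : (fun k => Z k ω) ∉ bad w' := fun hmem =>
      hω (subset_toMeasurable ν U (Set.mem_biUnion hw'T hmem))
    simp only [hbad, Set.mem_ofPred_eq, not_exists, not_le] at hgood
    have h1 := hgood ⟨h, hh⟩
    have h2 := FairFL.risk_sub_empRisk_le hN P hℓ huv.le hM
      (fun p => by rcases hℓuv p with h | h <;> rw [h] <;> constructor <;> linarith)
      (hH h hh) (fun k => Z k ω) hww'
    have hQ2 : FairFL.setSkewness L / (2 * (N * n)) = Q / 2 := by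
      rw [hQ]; field_simp
    -- The constant 4 is the 2 of symmetrization times the 2 gained by rewriting `√(2 * Q)` as `2 *
    -- √(Q / 2)`.
    have h3 : 2 * √(2 * D * Q) = √(Q / 2) * (4 * √d * √(1 + Real.log (N * n / d))) := by
      have h4 : 2 * D * Q = 2 ^ 2 * (Q / 2 * (d * (1 + Real.log (N * n / d)))) := by
        rw [hD]; ring
      rw [h4, Real.sqrt_mul (by norm_num), Real.sqrt_sq (by norm_num),
        Real.sqrt_mul (by positivity), Real.sqrt_mul (by positivity)]
      ring
    rw [hQ2, mul_add, ← h3, ← ht]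
    linarith
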